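/- Let $(\Lambda,\le)$ be a partially ordered set that is both upward and downward directed, and let $\mathcal M=\{M^x:x\in\Lambda\}$ be a weight matrix: each $M^x=(M^x_j)_{j\in\mathbb N}$ is an increasing sequence of positive reals with $1=M^x_0\le M^x_1$, and $M^x_j\le M^y_j$ for all $j\in\mathbb N$ whenever $x\le y$. Let $r\ge 1$. For a compact set $K\subset\mathbb R^r$ with smooth boundary (that is, near each of its boundary points $K$ is a sublevel set $\{\rho\le 0\}$ of a smooth real function $\rho$ with nowhere vanishing differential), a sequence $M$ of positive reals and $h>0$, let $\mathcal E_{M,h}(K)$ be the normed space of all smooth functions $f:K^\circ\to\mathbb R$ all of whose derivatives $f^{(j)}$ extend continuously to $K$ and for which $$\|f\|_{M,K,h}:=\sup_{j\in\mathbb N,\;x\in K}\frac{\|f^{(j)}(x)\|_{L^j(\mathbb R^r,\mathbb R)}}{h^jM_j}<\infty .$$ For $x\le y$ and $0<h\le k$ one has the inclusion $$\iota:\mathcal E_{M^x,h}(K)\longrightarrow\mathcal E_{M^y,k}(K),\qquad f\mapsto f.\tag{1}$$ A bounded operator $T:X\to Y$ is called nuclear if there are $u_j\in X'$ and $v_j\in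 Y$ with $\sum_j\|u_j\|\,\|v_j\|<\infty$ and $Tf=\sum_j u_j(f)\,v_j$ for all $f\in X$. (a) Suppose that for every $x\in\Lambda$ there are $C>0$ and $y\in\Lambda$ with $M^x_{j+1}\le C^{j+1}M^y_j$ for all $j\in\mathbb N$. Then for all $x\in\Lambda$ and $h>0$ there are $y\in\Lambda$ and $k>0$ with $x\le y$ and $h\le k$ such that (1) is nuclear for every compact set $K\subset\mathbb R^r$ with smooth boundary. (b) Suppose that for every $x\in\Lambda$ there are $C>0$ and $y\in\Lambda$ with $M^y_{j+1}\le C^{j+1}M^x_j$ for all $j\in\mathbb N$. Then for all $y\in\Lambda$ and $k>0$ there are $x\in\Lambda$ and $h>0$ with $x\le y$ and $h\le k$ such that (1) is nuclear for every compact set $K\subset\mathbb R^r$ with smooth boundary. -/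

import Mathlib

open Set Filter
open scoped Topology ContDiff

noncomputable section

/-- A weight sequence: a sequence of positive real numbers. -/
structure WeightSequence where
  toFun : ℕ → ℝ
  pos' : ∀ k, 0 < toFun k

namespace WeightSequence

instance : CoeFun WeightSequence (fun _ => ℕ → ℝ) := ⟨WeightSequence.toFun⟩

theorem pos (M : WeightSequence) (k : ℕ) : 0 < M k := M.pos' k

/-- Normalized: `1 = M₀ ≤ M₁`. -/
def IsNormalized (M : WeightSequence) : Prop := M 0 = 1 ∧ 1 ≤ M 1

end WeightSequence

/-- The condition `(𝓜)` on a family of weight sequences indexed by a partially ordered set. -/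
structure IsWeightMatrix {Λ : Type*} [PartialOrder Λ] (M : Λ → WeightSequence) : Prop where
  normalized : ∀ x, (M x).IsNormalized
  increasing : ∀ x, Monotone (M x).toFun
  le_of_le : ∀ ⦃x y : Λ⦄, x ≤ y → ∀ k, M x k ≤ M y k

/-- Derivation closedness of Roumieu type. -/
def RoumieuDC {Λ : Type*} (M : Λ → WeightSequence) : Prop :=
  ∀ x, ∃ C : ℝ, 0 < C ∧ ∃ y, ∀ j : ℕ, M x (j + 1) ≤ C ^ (j + 1) * M y j

/-- Derivation closedness of Beurling type. -/
def BeurlingDC {Λ : Type*} (M : Λ → WeightSequence) : Prop :=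
  ∀ x, ∃ C : ℝ, 0 < C ∧ ∃ y, ∀ j : ℕ, M y (j + 1) ≤ C ^ (j + 1) * M x j

/-- A compact subset of `ℝ^r` with smooth boundary: near each of its boundary points it is the
sublevel set `{ρ ≤ 0}` of a smooth function `ρ` without critical points. -/
structure SmoothCompact (r : ℕ) where
  carrier : Set (EuclideanSpace ℝ (Fin r))
  isCompact : IsCompact carrier
  smooth_boundary : ∀ p ∈ frontier carrier, ∃ U : Set (EuclideanSpace ℝ (Fin r)),
    IsOpen U ∧ p ∈ U ∧ ∃ ρ : EuclideanSpace ℝ (Fin r) → ℝ,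
      ContDiffOn ℝ ∞ ρ U ∧ (∀ x ∈ U, fderiv ℝ ρ x ≠ 0) ∧
      carrier ∩ U = {x | x ∈ U ∧ ρ x ≤ 0}

namespace SmoothCompact

variable {r : ℕ} (K : SmoothCompact r)

theorem subset_closure_interior : K.carrier ⊆ closure (interior K.carrier) := by
  intro p hp
  by_cases hpi : p ∈ interior K.carrier
  · exact subset_closure hpi
  have hfr : p ∈ frontier K.carrier := ⟨subset_closure hp, hpi⟩
  obtain ⟨U, hU, hpU, ρ, hρ, hd, hEq⟩ := K.smooth_boundary p hfr
  by_contra hcl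
  refine hd p hpU (IsLocalMin.fderiv_eq_zero ?_)
  have hρp : ρ p ≤ 0 := by
    have : p ∈ K.carrier ∩ U := ⟨hp, hpU⟩
    rw [hEq] at this
    exact this.2
  have hnear : ∀ᶠ x in 𝓝 p, x ∈ U ∧ x ∈ (closure (interior K.carrier))ᶜ :=
    Filter.Eventually.and (hU.mem_nhds hpU) (isClosed_closure.isOpen_compl.mem_nhds hcl)
  filter_upwards [hnear] with x hx
  refine hρp.trans ?_
  by_contra hneg
  push Not at hneg
  refine hx.2 (subset_closure ?_)
  have hcont : ContinuousAt ρ x := hρ.continuousOn.continuousAt (hU.mem_nhds hx.1)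
  rw [mem_interior_iff_mem_nhds]
  filter_upwards [hcont.eventually_lt continuousAt_const hneg, hU.mem_nhds hx.1] with z hz hzU
  have : z ∈ K.carrier ∩ U := by
    rw [hEq]
    exact ⟨hzU, le_of_lt hz⟩
  exact this.1

end SmoothCompact

/-- The `k`-th Fréchet derivative of `f` on `K`: the derivative in the interior of `K`, extended by
continuity to `K`. -/
def derivOn {r : ℕ} (K : SmoothCompact r) (f : EuclideanSpace ℝ (Fin r) → ℝ) (k : ℕ) :
    EuclideanSpace ℝ (Fin r) → (EuclideanSpace ℝ (Fin r)) [×k]→L[ℝ] ℝ :=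
  extendFrom (interior K.carrier) (iteratedFDeriv ℝ k f)

/-- `f` is smooth on the interior of `K` and each of its derivatives can be continuously extended
to `K`. A function on the interior of `K` is represented by its extension by zero, so that distinct
elements are distinct functions on the interior. -/
structure IsSmoothOn {r : ℕ} (K : SmoothCompact r) (f : EuclideanSpace ℝ (Fin r) → ℝ) : Prop where
  eq_zero : ∀ x ∉ interior K.carrier, f x = 0
  contDiffOn : ContDiffOn ℝ ∞ f (interior K.carrier)
  exists_extension : ∀ k : ℕ,
    ∃ g : EuclideanSpace ℝ (Fin r) → (EuclideanSpace ℝ (Fin r)) [×k]→L[ℝ] ℝ,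
      ContinuousOn g K.carrier ∧ EqOn g (iteratedFDeriv ℝ k f) (interior K.carrier)

section DerivOn

variable {r : ℕ} {K : SmoothCompact r} {f g : EuclideanSpace ℝ (Fin r) → ℝ}

theorem IsSmoothOn.contDiffAt (hf : IsSmoothOn K f) (k : ℕ) {x : EuclideanSpace ℝ (Fin r)}
    (hx : x ∈ interior K.carrier) : ContDiffAt ℝ k f x :=
  (hf.contDiffOn.contDiffAt (isOpen_interior.mem_nhds hx)).of_le (by exact_mod_cast le_top)

theorem IsSmoothOn.tendsto (hf : IsSmoothOn K f) (k : ℕ) {x : EuclideanSpace ℝ (Fin r)}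
    (hx : x ∈ K.carrier) :
    Tendsto (iteratedFDeriv ℝ k f) (𝓝[interior K.carrier] x) (𝓝 (derivOn K f k x)) := by
  obtain ⟨g, hg, hgf⟩ := hf.exists_extension k
  refine tendsto_extendFrom ⟨g x, ?_⟩
  exact ((hg x hx).mono_left (nhdsWithin_mono x interior_subset)).congr'
    (hgf.eventuallyEq_of_mem self_mem_nhdsWithin)

theorem derivOn_eq_of_tendsto {k : ℕ} {x : EuclideanSpace ℝ (Fin r)} (hx : x ∈ K.carrier)
    {y : (EuclideanSpace ℝ (Fin r)) [×k]→L[ℝ] ℝ}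
    (h : Tendsto (iteratedFDeriv ℝ k f) (𝓝[interior K.carrier] x) (𝓝 y)) :
    derivOn K f k x = y :=
  extendFrom_eq (K.subset_closure_interior hx) h

theorem IsSmoothOn.derivOn_of_mem_interior (hf : IsSmoothOn K f) (k : ℕ)
    {x : EuclideanSpace ℝ (Fin r)} (hx : x ∈ interior K.carrier) :
    derivOn K f k x = iteratedFDeriv ℝ k f x := by
  obtain ⟨g, hg, hgf⟩ := hf.exists_extension k
  refine derivOn_eq_of_tendsto (interior_subset hx) ?_
  rw [← hgf hx]
  exact ((hg x (interior_subset hx)).mono_left (nhdsWithin_mono x interior_subset)).congr'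
    (hgf.eventuallyEq_of_mem self_mem_nhdsWithin)

theorem iteratedFDeriv_add_eqOn (hf : IsSmoothOn K f) (hg : IsSmoothOn K g) (k : ℕ) :
    EqOn (iteratedFDeriv ℝ k f + iteratedFDeriv ℝ k g) (iteratedFDeriv ℝ k (f + g))
      (interior K.carrier) := fun _ hx =>
  (iteratedFDeriv_add_apply (hf.contDiffAt k hx) (hg.contDiffAt k hx)).symm

theorem iteratedFDeriv_smul_eqOn (c : ℝ) (hf : IsSmoothOn K f) (k : ℕ) :
    EqOn (c • iteratedFDeriv ℝ k f) (iteratedFDeriv ℝ k (c • f)) (interior K.carrier) :=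
  fun _ hx => (iteratedFDeriv_const_smul_apply (hf.contDiffAt k hx)).symm

theorem IsSmoothOn.zero : IsSmoothOn K 0 where
  eq_zero _ _ := rfl
  contDiffOn := contDiffOn_const
  exists_extension k := ⟨0, continuousOn_const, fun x _ => by
    have h0 : iteratedFDeriv ℝ k (0 : EuclideanSpace ℝ (Fin r) → ℝ) = 0 := iteratedFDeriv_fun_zero
    rw [h0]⟩

theorem IsSmoothOn.add (hf : IsSmoothOn K f) (hg : IsSmoothOn K g) : IsSmoothOn K (f + g) where
  eq_zero x hx := by simp [hf.eq_zero x hx, hg.eq_zero x hx]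
  contDiffOn := hf.contDiffOn.add hg.contDiffOn
  exists_extension k := by
    obtain ⟨a, ha, haf⟩ := hf.exists_extension k
    obtain ⟨b, hb, hbg⟩ := hg.exists_extension k
    refine ⟨a + b, ha.add hb, fun x hx => ?_⟩
    rw [← iteratedFDeriv_add_eqOn hf hg k hx, Pi.add_apply, Pi.add_apply, haf hx, hbg hx]

theorem IsSmoothOn.smul (c : ℝ) (hf : IsSmoothOn K f) : IsSmoothOn K (c • f) where
  eq_zero x hx := by simp [hf.eq_zero x hx]
  contDiffOn := contDiffOn_const.smul hf.contDiffOn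
  exists_extension k := by
    obtain ⟨a, ha, haf⟩ := hf.exists_extension k
    refine ⟨c • a, ha.const_smul c, fun x hx => ?_⟩
    rw [← iteratedFDeriv_smul_eqOn c hf k hx, Pi.smul_apply, Pi.smul_apply, haf hx]

theorem derivOn_add (hf : IsSmoothOn K f) (hg : IsSmoothOn K g) (k : ℕ)
    {x : EuclideanSpace ℝ (Fin r)} (hx : x ∈ K.carrier) :
    derivOn K (f + g) k x = derivOn K f k x + derivOn K g k x :=
  derivOn_eq_of_tendsto hx (((hf.tendsto k hx).add (hg.tendsto k hx)).congr'
    ((iteratedFDeriv_add_eqOn hf hg k).eventuallyEq_of_mem self_mem_nhdsWithin))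

theorem derivOn_smul (c : ℝ) (hf : IsSmoothOn K f) (k : ℕ)
    {x : EuclideanSpace ℝ (Fin r)} (hx : x ∈ K.carrier) :
    derivOn K (c • f) k x = c • derivOn K f k x :=
  derivOn_eq_of_tendsto hx (((hf.tendsto k hx).const_smul c).congr'
    ((iteratedFDeriv_smul_eqOn c hf k).eventuallyEq_of_mem self_mem_nhdsWithin))

theorem derivOn_zero (k : ℕ) {x : EuclideanSpace ℝ (Fin r)} (hx : x ∈ K.carrier) :
    derivOn K 0 k x = 0 := by
  have := derivOn_smul (0 : ℝ) (IsSmoothOn.zero (K := K)) k hx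
  simpa using this

end DerivOn

/-- The quotients `‖f⁽ᵏ⁾(x)‖ / (hᵏ M_k)`, for `k ∈ ℕ` and `x ∈ K`. -/
def weightedQuot {r : ℕ} (K : SmoothCompact r) (M : WeightSequence) (h : Ioi (0 : ℝ))
    (f : EuclideanSpace ℝ (Fin r) → ℝ) (p : ℕ × K.carrier) : ℝ :=
  ‖derivOn K f p.1 p.2‖ / ((h : ℝ) ^ p.1 * M p.1)

section WeightedQuot

variable {r : ℕ} {K : SmoothCompact r} {M N : WeightSequence} {h k : Ioi (0 : ℝ)}
  {f g : EuclideanSpace ℝ (Fin r) → ℝ}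

theorem weight_pos (M : WeightSequence) (h : Ioi (0 : ℝ)) (j : ℕ) : 0 < (h : ℝ) ^ j * M j :=
  mul_pos (pow_pos h.2 j) (M.pos j)

theorem weightedQuot_nonneg (p : ℕ × K.carrier) : 0 ≤ weightedQuot K M h f p :=
  div_nonneg (norm_nonneg _) (weight_pos M h p.1).le

theorem weightedQuot_add_le (hf : IsSmoothOn K f) (hg : IsSmoothOn K g) (p : ℕ × K.carrier) :
    weightedQuot K M h (f + g) p ≤ weightedQuot K M h f p + weightedQuot K M h g p := by
  unfold weightedQuot
  rw [derivOn_add hf hg p.1 p.2.2, ← add_div]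
  exact div_le_div_of_nonneg_right (norm_add_le _ _) (weight_pos M h p.1).le

theorem weightedQuot_smul (c : ℝ) (hf : IsSmoothOn K f) (p : ℕ × K.carrier) :
    weightedQuot K M h (c • f) p = ‖c‖ * weightedQuot K M h f p := by
  unfold weightedQuot
  rw [derivOn_smul c hf p.1 p.2.2, norm_smul, mul_div_assoc]

theorem weightedQuot_le (hMN : ∀ j, M j ≤ N j) (hhk : h ≤ k) (p : ℕ × K.carrier) :
    weightedQuot K N k f p ≤ weightedQuot K M h f p :=
  div_le_div_of_nonneg_left (norm_nonneg _) (weight_pos M h p.1)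
    (mul_le_mul (pow_le_pow_left₀ (le_of_lt (mem_Ioi.1 h.2)) (Subtype.coe_le_coe.2 hhk) _) (hMN _) (M.pos _).le
      (pow_nonneg (le_of_lt (mem_Ioi.1 k.2)) _))

end WeightedQuot

/-- The vector space underlying `ℰ_{M,h}(K, ℝ)`: the smooth functions on `K` with
`sup_{k ∈ ℕ, x ∈ K} ‖f⁽ᵏ⁾(x)‖ / (hᵏ M_k) < ∞`. -/
def ultraSubmodule {r : ℕ} (K : SmoothCompact r) (M : WeightSequence) (h : Ioi (0 : ℝ)) :
    Submodule ℝ (EuclideanSpace ℝ (Fin r) → ℝ) where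
  carrier := {f | IsSmoothOn K f ∧ BddAbove (range (weightedQuot K M h f))}
  zero_mem' := by
    refine ⟨IsSmoothOn.zero, 0, ?_⟩
    rintro _ ⟨p, rfl⟩
    simp [weightedQuot, derivOn_zero p.1 p.2.2]
  add_mem' := by
    rintro f g ⟨hf, A, hA⟩ ⟨hg, B, hB⟩
    refine ⟨hf.add hg, A + B, ?_⟩
    rintro _ ⟨p, rfl⟩
    exact (weightedQuot_add_le hf hg p).trans (add_le_add (hA ⟨p, rfl⟩) (hB ⟨p, rfl⟩))
  smul_mem' := by
    rintro c f ⟨hf, A, hA⟩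
    refine ⟨hf.smul c, ‖c‖ * A, ?_⟩
    rintro _ ⟨p, rfl⟩
    rw [weightedQuot_smul c hf]
    exact mul_le_mul_of_nonneg_left (hA ⟨p, rfl⟩) (norm_nonneg c)

/-- The space `ℰ_{M,h}(K, ℝ)`. -/
def UltraSpace {r : ℕ} (K : SmoothCompact r) (M : WeightSequence) (h : Ioi (0 : ℝ)) : Type :=
  {f : EuclideanSpace ℝ (Fin r) → ℝ // f ∈ ultraSubmodule K M h}

namespace UltraSpace

variable {r : ℕ} {K : SmoothCompact r} {M N : WeightSequence} {h k : Ioi (0 : ℝ)}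

instance : AddCommGroup (UltraSpace K M h) :=
  inferInstanceAs (AddCommGroup (ultraSubmodule K M h))

instance : Module ℝ (UltraSpace K M h) :=
  inferInstanceAs (Module ℝ (ultraSubmodule K M h))

/-- The norm `‖f‖_{M,K,h} = sup_{k ∈ ℕ, x ∈ K} ‖f⁽ᵏ⁾(x)‖ / (hᵏ M_k)`. -/
instance : Norm (UltraSpace K M h) := ⟨fun f => ⨆ p, weightedQuot K M h f.1 p⟩

theorem norm_def (f : UltraSpace K M h) : ‖f‖ = ⨆ p, weightedQuot K M h f.1 p := rfl

theorem weightedQuot_le_norm (f : UltraSpace K M h) (p : ℕ × K.carrier) :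
    weightedQuot K M h f.1 p ≤ ‖f‖ := le_ciSup f.2.2 p

theorem norm_nonneg' (f : UltraSpace K M h) : 0 ≤ ‖f‖ :=
  Real.iSup_nonneg fun p => weightedQuot_nonneg p

theorem norm_le' {f : UltraSpace K M h} {A : ℝ} (hA : 0 ≤ A)
    (hf : ∀ p, weightedQuot K M h f.1 p ≤ A) : ‖f‖ ≤ A := Real.iSup_le hf hA

theorem core : NormedSpace.Core ℝ (UltraSpace K M h) where
  norm_nonneg := norm_nonneg'
  norm_smul c f := by
    rw [norm_def, norm_def, Real.mul_iSup_of_nonneg (norm_nonneg c)]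
    exact iSup_congr fun p => weightedQuot_smul c f.2.1 p
  norm_triangle f g := norm_le' (add_nonneg (norm_nonneg' f) (norm_nonneg' g)) fun p =>
    (weightedQuot_add_le f.2.1 g.2.1 p).trans
      (add_le_add (weightedQuot_le_norm f p) (weightedQuot_le_norm g p))
  norm_eq_zero_iff f := by
    constructor
    · intro hf
      apply Subtype.ext
      funext x
      by_cases hx : x ∈ interior K.carrier
      · have h0 : weightedQuot K M h f.1 (0, ⟨x, interior_subset hx⟩) ≤ 0 :=
          hf ▸ weightedQuot_le_norm f _
        have h1 : weightedQuot K M h f.1 (0, ⟨x, interior_subset hx⟩) = 0 :=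
          le_antisymm h0 (weightedQuot_nonneg _)
        unfold weightedQuot at h1
        rw [div_eq_zero_iff, or_iff_left (weight_pos M h 0).ne', norm_eq_zero] at h1
        have h2 : iteratedFDeriv ℝ 0 f.1 x = 0 := by
          rw [← f.2.1.derivOn_of_mem_interior 0 hx]
          exact h1
        have h3 : iteratedFDeriv ℝ 0 f.1 x 0 = f.1 x := iteratedFDeriv_zero_apply _
        rw [h2] at h3
        exact h3.symm
      · exact f.2.1.eq_zero x hx
    · rintro rfl
      refine le_antisymm (norm_le' le_rfl fun p => ?_) (norm_nonneg' _)
      change weightedQuot K M h 0 p ≤ 0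
      simp [weightedQuot, derivOn_zero p.1 p.2.2]

instance : NormedAddCommGroup (UltraSpace K M h) := NormedAddCommGroup.ofCore core

instance : NormedSpace ℝ (UltraSpace K M h) := NormedSpace.ofCore core

/-- The inclusion `ℰ_{M,h}(K, ℝ) → ℰ_{N,k}(K, ℝ)`, `f ↦ f`, for `M ≤ N` and `h ≤ k`. -/
def inclusion (K : SmoothCompact r) (hMN : ∀ j, M j ≤ N j) (hhk : h ≤ k) :
    UltraSpace K M h →L[ℝ] UltraSpace K N k :=
  LinearMap.mkContinuous
    { toFun := fun f => ⟨f.1, f.2.1, ‖f‖, by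
        rintro _ ⟨p, rfl⟩
        exact (weightedQuot_le hMN hhk p).trans (weightedQuot_le_norm f p)⟩
      map_add' := fun _ _ => rfl
      map_smul' := fun _ _ => rfl }
    1 fun f => by
      rw [one_mul]
      exact norm_le' (norm_nonneg' f) fun p =>
        (weightedQuot_le hMN hhk p).trans (weightedQuot_le_norm f p)

end UltraSpace

/-- A bounded operator `T : X → Y` between normed spaces is nuclear if there are functionals
`u_j ∈ X'` and vectors `v_j ∈ Y` with `∑ ‖u_j‖ ‖v_j‖ < ∞` and `T f = ∑ u_j(f) v_j` for all `f`. -/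
def IsNuclear {X Y : Type*} [NormedAddCommGroup X] [NormedSpace ℝ X]
    [NormedAddCommGroup Y] [NormedSpace ℝ Y] (T : X →L[ℝ] Y) : Prop :=
  ∃ (u : ℕ → (X →L[ℝ] ℝ)) (v : ℕ → Y),
    Summable (fun j => ‖u j‖ * ‖v j‖) ∧ ∀ f : X, HasSum (fun j => u j f • v j) (T f)

end

/-! An operator is nuclear as soon as it is exponentially small on the common kernels of finite
families of functionals that grow slowly enough. Suppose the n-th family has at most A B^n members
and ‖T f‖ ≤ A q^n ‖f‖ on its common kernel, where B² q < 1. Almost-Auerbach systems give finite rank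
projections Q_n along these kernels with norms O(B^n). For nested kernels, T is the sum of the
blocks T (1 - Q_n) Q_{n+1}; block n has O(B^n) rank-one terms of size O((B q)^n), hence the
condition on B² q (`isNuclear_of_finset`).

For the inclusion, the functionals are the partial derivatives of order < n + m at a net of scale
proportional to 2^(-n), which gives B = 2^r (r + 1). Let them all vanish at f. For orders j ≤ n,
integrating m times from net points gains 2^(-nm) and replaces M_j by M_{j+m}, a loss that iterated
derivation closedness absorbs. For orders j > n, a ratio h ≤ q k gains q^n. Integrating requires
paths inside K of length comparable to the distance; the smooth boundary provides them
(`SmoothCompact.exists_three_segments`).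

The set K affects only the prefactor A. As q and m depend on r alone, the new index and radius serve
all K at once. -/

/-! ### Nuclearity from smallness on kernels of finitely many functionals -/

/-- An approximate Auerbach system for the annihilated quotient of a finite set of functionals. -/
theorem exists_approx_auerbach {X : Type*} [NormedAddCommGroup X] [NormedSpace ℝ X]
    (F : Finset (X →L[ℝ] ℝ)) :
    ∃ (d : ℕ) (u : Fin d → X →L[ℝ] ℝ) (x : Fin d → X), d ≤ F.card ∧
      (∀ i, ‖u i‖ ≤ 2) ∧ (∀ i, ‖x i‖ ≤ 1) ∧
      (∀ f, (∀ φ ∈ F, φ f = 0) → ∀ i, u i f = 0) ∧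
      ∀ f, ∀ φ ∈ F, φ (f - ∑ i, u i f • x i) = 0 := by
  classical
  let Φ : X →ₗ[ℝ] (F → ℝ) := LinearMap.pi fun φ => (φ.1 : X →ₗ[ℝ] ℝ)
  have hΦc : Continuous Φ := continuous_pi fun φ => φ.1.continuous
  let π := Φ.rangeRestrict
  have hπc : Continuous π := hΦc.subtype_mk _
  let b := Module.finBasis ℝ (LinearMap.range Φ)
  set d := Module.finrank ℝ (LinearMap.range Φ)
  have hd : d ≤ F.card := by
    have := Submodule.finrank_le (LinearMap.range Φ)
    simpa using this
  let L : Fin d → X →L[ℝ] ℝ := fun i =>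
    ⟨b.coord i ∘ₗ π, (LinearMap.continuous_of_finiteDimensional (b.coord i)).comp hπc⟩
  -- As in Auerbach's lemma, vectors of the unit ball with almost maximal determinant are sought.
  let D : (Fin d → X) → ℝ := fun x => b.det fun i => π (x i)
  let s : Set ℝ := {a | ∃ x : Fin d → X, (∀ i, ‖x i‖ ≤ 1) ∧ a = |D x|}
  have hbdd : BddAbove s := by
    refine ⟨(Fintype.card (Fin d)).factorial • (∑ i, ‖L i‖) ^ Fintype.card (Fin d), ?_⟩
    rintro _ ⟨x, hx, rfl⟩
    change |b.det _| ≤ _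
    rw [Module.Basis.det_apply]
    refine Matrix.det_le (abv := IsAbsoluteValue.toAbsoluteValue (abs : ℝ → ℝ)) fun i j => ?_
    change ‖L i (x j)‖ ≤ _
    calc ‖L i (x j)‖ ≤ ‖L i‖ * ‖x j‖ := (L i).le_opNorm _
      _ ≤ ‖L i‖ := mul_le_of_le_one_right (norm_nonneg _) (hx j)
      _ ≤ ∑ i, ‖L i‖ := Finset.single_le_sum (f := fun i => ‖L i‖)
          (fun _ _ => norm_nonneg _) (Finset.mem_univ i)
  obtain ⟨a, has, ha0⟩ : ∃ a ∈ s, 0 < a := by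
    choose y hy using fun i => Φ.surjective_rangeRestrict (b i)
    have hS : 0 < 1 + ∑ i, ‖y i‖ := by positivity
    refine ⟨_, ⟨fun i => (1 + ∑ i, ‖y i‖)⁻¹ • y i, fun i => ?_, rfl⟩, ?_⟩
    · rw [norm_smul, norm_inv, Real.norm_of_nonneg hS.le, inv_mul_le_iff₀ hS, mul_one]
      have := Finset.single_le_sum (f := fun i => ‖y i‖)
          (fun _ _ => norm_nonneg _) (Finset.mem_univ i)
      linarith
    · have : D (fun i => (1 + ∑ i, ‖y i‖)⁻¹ • y i) = ∏ _i : Fin d, (1 + ∑ i, ‖y i‖)⁻¹ := by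
        change b.det (fun i => π ((1 + ∑ i, ‖y i‖)⁻¹ • y i)) = _
        have hy' : ∀ i, π (y i) = b i := hy
        simp only [map_smul, hy']
        refine (b.det.toMultilinearMap.map_smul_univ _ b).trans ?_
        change _ • b.det b = _
        rw [b.det_self, smul_eq_mul, mul_one]
      rw [this]
      exact abs_pos.2 (by positivity)
  have hsup : 0 < sSup s := ha0.trans_le (le_csSup hbdd has)
  -- The supremum need not be attained; settling for more than half of it turns the usual bound 1 on
  -- the coordinates into 2.
  obtain ⟨_, ⟨x, hx, rfl⟩, hlt⟩ := exists_lt_of_lt_csSup ⟨a, has⟩ (half_lt_self hsup)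
  have hDpos : 0 < |D x| := (half_pos hsup).trans hlt
  have hD0 : D x ≠ 0 := abs_pos.1 hDpos
  obtain ⟨hli, hsp⟩ := (b.is_basis_iff_det (v := fun i => π (x i))).2 hD0.isUnit
  let b' := Module.Basis.mk hli hsp.ge
  -- Cramer's rule: a coordinate is a quotient of two determinants, the numerator being at most the
  -- supremum when ‖f‖ ≤ 1.
  have hcoord : ∀ i f, D x * b'.coord i (π f) = D (Function.update x i f) := by
    intro i f
    have := congrArg (fun l => l (π f)) (b.det_smul_mk_coord_eq_det_update hli hsp.ge i)
    simp only [LinearMap.smul_apply, smul_eq_mul] at this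
    refine this.trans ?_
    change b.det (Function.update _ _ _) = b.det _
    congr 1
    funext j
    by_cases hj : j = i
    · subst hj; simp
    · simp [hj]
  have hunit : ∀ i f, ‖f‖ ≤ 1 → |b'.coord i (π f)| ≤ 2 := by
    intro i f hf
    have h1 : |D (Function.update x i f)| ≤ sSup s := by
      refine le_csSup hbdd ⟨_, fun j => ?_, rfl⟩
      by_cases hj : j = i
      · subst hj; simpa using hf
      · simpa [hj] using hx j
    rw [← hcoord, abs_mul] at h1
    by_contra hcon
    push Not at hcon
    nlinarith
  have hbound : ∀ i f, ‖(b'.coord i ∘ₗ π) f‖ ≤ 2 * ‖f‖ := by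
    intro i f
    rcases eq_or_ne f 0 with rfl | hf
    · simp
    have hn : 0 < ‖f‖ := norm_pos_iff.2 hf
    have := hunit i (‖f‖⁻¹ • f) (by rw [norm_smul, norm_inv, norm_norm, inv_mul_cancel₀ hn.ne'])
    rw [map_smul, map_smul, smul_eq_mul, abs_mul, abs_of_pos (inv_pos.2 hn),
      inv_mul_le_iff₀ hn, mul_comm] at this
    exact this
  refine ⟨d, fun i => (b'.coord i ∘ₗ π).mkContinuous 2 (hbound i), x, hd, fun i =>
    LinearMap.mkContinuous_norm_le _ (by norm_num) _, hx, fun f hf i => ?_, fun f φ hφ => ?_⟩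
  · have : π f = 0 := Subtype.ext (funext fun φ => hf φ.1 φ.2)
    simp [this]
  · have h1 : π (f - ∑ i, b'.coord i (π f) • x i) = 0 := by
      rw [map_sub, map_sum, sub_eq_zero]
      conv_lhs => rw [← b'.sum_repr (π f)]
      refine Finset.sum_congr rfl fun i _ => ?_
      rw [map_smul]
      simp [b']
    exact congrFun (congrArg Subtype.val h1) ⟨φ, hφ⟩

section Nuclear

variable {X Y : Type*} [NormedAddCommGroup X] [NormedSpace ℝ X]
  [NormedAddCommGroup Y] [NormedSpace ℝ Y]

theorem isNuclear_of_countable {T : X →L[ℝ] Y} {ι : Type*} [Countable ι]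
    (u : ι → X →L[ℝ] ℝ) (v : ι → Y) (hs : Summable fun i => ‖u i‖ * ‖v i‖)
    (h : ∀ f, HasSum (fun i => u i f • v i) (T f)) : IsNuclear T := by
  obtain ⟨e, he⟩ := exists_injective_nat ι
  refine ⟨Function.extend e u 0, Function.extend e v 0, ?_, fun f => ?_⟩
  · convert (summable_extend_zero he).2 hs using 1
    funext j
    by_cases hj : ∃ i, e i = j
    · obtain ⟨i, rfl⟩ := hj
      simp [he.extend_apply]
    · simp [Function.extend_apply' _ _ _ hj]
  · convert (hasSum_extend_zero he).2 (h f) using 1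
    funext j
    by_cases hj : ∃ i, e i = j
    · obtain ⟨i, rfl⟩ := hj
      simp [he.extend_apply]
    · simp [Function.extend_apply' _ _ _ hj]

/-- Convergence is only assumed along whole blocks; absolute summability upgrades it to
unconditional convergence with the same limit. -/
theorem isNuclear_of_blocks {T : X →L[ℝ] Y} {d : ℕ → ℕ} (u : ∀ n, Fin (d n) → X →L[ℝ] ℝ)
    (v : ∀ n, Fin (d n) → Y) {c : ℕ → ℝ} (hc : Summable c)
    (huv : ∀ n, ∑ i, ‖u n i‖ * ‖v n i‖ ≤ c n)
    (hT : ∀ f, Tendsto (fun n => ∑ k ∈ Finset.range n, ∑ i, u k i f • v k i) atTop (𝓝 (T f))) :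
    IsNuclear T := by
  have hs : Summable fun p : Σ n, Fin (d n) => ‖u p.1 p.2‖ * ‖v p.1 p.2‖ := by
    rw [summable_sigma_of_nonneg fun _ => by positivity]
    refine ⟨fun n => Summable.of_finite, ?_⟩
    refine Summable.of_nonneg_of_le (fun n => tsum_nonneg fun _ => by positivity) (fun n => ?_) hc
    rw [tsum_fintype]
    exact huv n
  refine isNuclear_of_countable (fun p : Σ n, Fin (d n) => u p.1 p.2) (fun p => v p.1 p.2) hs
    fun f => ?_
  -- Absolute summability implies summability only in a complete space, so the sum is formed in the
  -- completion and identified there with the image of T f.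
  let I : Y →L[ℝ] UniformSpace.Completion Y := UniformSpace.Completion.toComplL
  have hI : Topology.IsInducing I := (UniformSpace.Completion.isUniformInducing_coe Y).isInducing
  have hIn : ∀ y, ‖I y‖ = ‖y‖ := fun y => UniformSpace.Completion.norm_coe y
  rw [← hI.hasSum_iff]
  have hsum : Summable (I ∘ fun p : Σ n, Fin (d n) => u p.1 p.2 f • v p.1 p.2) := by
    refine Summable.of_norm_bounded (hs.mul_left ‖f‖) fun p => ?_
    rw [Function.comp_apply, hIn, norm_smul, ← mul_assoc, mul_comm ‖f‖]
    exact mul_le_mul_of_nonneg_right ((u p.1 p.2).le_opNorm f) (norm_nonneg _)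
  have h1 := hsum.hasSum.sigma (fun n => hasSum_fintype _)
  have h2 := (I.continuous.tendsto _).comp (hT f)
  have h3 : Tendsto (fun n => I (∑ k ∈ Finset.range n, ∑ i, u k i f • v k i)) atTop
      (𝓝 (∑' p, (I ∘ fun p : Σ n, Fin (d n) => u p.1 p.2 f • v p.1 p.2) p)) := by
    refine h1.tendsto_sum_nat.congr fun n => ?_
    simp only [map_sum, Function.comp_apply]
  rw [← tendsto_nhds_unique h3 h2]
  exact hsum.hasSum

/-- Telescoping along the projections Q_n; `hF0` makes Q_0 = 0, so that the partial sums are exactly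
T Q_n f. -/
theorem isNuclear_of_monotone {T : X →L[ℝ] Y} (F : ℕ → Finset (X →L[ℝ] ℝ)) (hF : Monotone F)
    (hF0 : F 0 = ∅) {A B q : ℝ} (hA : 0 ≤ A) (hB : 1 ≤ B) (hq : 0 < q) (hBq : B ^ 2 * q < 1)
    (hcard : ∀ n, ((F n).card : ℝ) ≤ A * B ^ n)
    (hTF : ∀ n f, (∀ φ ∈ F n, φ f = 0) → ‖T f‖ ≤ A * q ^ n * ‖f‖) : IsNuclear T := by
  choose d u x hd hu hx hker hrep using fun n => exists_approx_auerbach (F n)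
  let Q : ∀ n, X →ₗ[ℝ] X := fun n => ∑ i, (u n i : X →ₗ[ℝ] ℝ).smulRight (x n i)
  have hQ : ∀ n f, Q n f = ∑ i, u n i f • x n i := fun n f => by simp [Q]
  have hdn : ∀ n, (d n : ℝ) ≤ A * B ^ n := fun n => (Nat.cast_le.2 (hd n)).trans (hcard n)
  have hQn : ∀ n f, ‖f - Q n f‖ ≤ (1 + 2 * A) * B ^ n * ‖f‖ := by
    intro n f
    have h1 : ‖Q n f‖ ≤ d n * (2 * ‖f‖) := by
      rw [hQ]
      refine (norm_sum_le_of_le (n := fun _ => 2 * ‖f‖) _ fun i _ => ?_).trans (by simp)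
      rw [norm_smul]
      calc ‖u n i f‖ * ‖x n i‖ ≤ (2 * ‖f‖) * 1 :=
            mul_le_mul ((u n i).le_of_opNorm_le (hu n i) f) (hx n i) (norm_nonneg _) (by positivity)
        _ = 2 * ‖f‖ := mul_one _
    have h2 : (1 : ℝ) ≤ B ^ n := one_le_pow₀ hB
    have h3 := mul_le_mul_of_nonneg_right (hdn n) (norm_nonneg f)
    have h4 := mul_le_mul_of_nonneg_right h2 (norm_nonneg f)
    calc ‖f - Q n f‖ ≤ ‖f‖ + ‖Q n f‖ := norm_sub_le _ _
      _ ≤ _ := by nlinarith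
  have hR : ∀ n f, ‖T (f - Q n f)‖ ≤ A * (1 + 2 * A) * (B * q) ^ n * ‖f‖ := by
    intro n f
    refine (hTF n _ fun φ hφ => by rw [hQ]; exact hrep n f φ hφ).trans ?_
    calc A * q ^ n * ‖f - Q n f‖ ≤ A * q ^ n * ((1 + 2 * A) * B ^ n * ‖f‖) :=
          mul_le_mul_of_nonneg_left (hQn n f) (by positivity)
      _ = _ := by rw [mul_pow]; ring
  have hQ0 : ∀ f, Q 0 f = 0 := by
    intro f
    have : d 0 = 0 := by simpa [hF0] using hd 0
    rw [hQ]
    refine Finset.sum_eq_zero fun i _ => ?_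
    exact absurd i.2 (by omega)
  -- Q_n f depends only on the values of F n at f, and passing from f to Q_{n+1} f preserves the
  -- values of the larger family F (n + 1).
  have hQQ : ∀ n f, Q n (Q (n + 1) f) = Q n f := by
    intro n f
    have : Q n (f - Q (n + 1) f) = 0 := by
      rw [hQ]
      refine Finset.sum_eq_zero fun i _ => ?_
      rw [hker n _ (fun φ hφ => ?_) i, zero_smul]
      rw [hQ]
      exact hrep (n + 1) f φ (hF n.le_succ hφ)
    rw [map_sub, sub_eq_zero] at this
    exact this.symm
  have hBq0 : 0 ≤ B * q := by positivity
  have hBq1 : B * q < 1 := by nlinarith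
  refine isNuclear_of_blocks (d := fun n => d (n + 1)) (fun n i => u (n + 1) i)
    (fun n i => T (x (n + 1) i - Q n (x (n + 1) i)))
    (c := fun n => (A * B * 2 * (A * (1 + 2 * A))) * (B ^ 2 * q) ^ n)
    ((summable_geometric_of_lt_one (by positivity) hBq).mul_left _) (fun n => ?_) fun f => ?_
  · have h1 : ∀ i, ‖u (n + 1) i‖ * ‖T (x (n + 1) i - Q n (x (n + 1) i))‖ ≤
        2 * (A * (1 + 2 * A) * (B * q) ^ n) := fun i =>
      mul_le_mul (hu _ i) ((hR n _).trans (mul_le_of_le_one_right (by positivity) (hx _ i)))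
        (norm_nonneg _) (by norm_num)
    calc _ ≤ ∑ _i : Fin (d (n + 1)), 2 * (A * (1 + 2 * A) * (B * q) ^ n) :=
          Finset.sum_le_sum fun i _ => h1 i
      _ = d (n + 1) * (2 * (A * (1 + 2 * A) * (B * q) ^ n)) := by simp
      _ ≤ (A * B ^ (n + 1)) * (2 * (A * (1 + 2 * A) * (B * q) ^ n)) :=
          mul_le_mul_of_nonneg_right (hdn _) (by positivity)
      _ = _ := by ring
  · have h1 : ∀ n, ∑ k ∈ Finset.range n, ∑ i, u (k + 1) i f • T (x (k + 1) i - Q k (x (k + 1) i))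
        = T f - T (f - Q n f) := by
      intro n
      rw [map_sub, sub_sub_cancel]
      induction n with
      | zero => simp [hQ0]
      | succ n ih =>
        rw [Finset.sum_range_succ, ih]
        have : ∑ i, u (n + 1) i f • T (x (n + 1) i - Q n (x (n + 1) i)) =
            T (Q (n + 1) f - Q n (Q (n + 1) f)) := by
          rw [hQ (n + 1) f]
          simp only [map_sub, map_sum, map_smul, smul_sub, Finset.sum_sub_distrib]
        rw [this, hQQ, map_sub]
        abel
    simp only [h1]
    have h2 : Tendsto (fun n => T (f - Q n f)) atTop (𝓝 0) := by
      refine squeeze_zero_norm (hR · f) ?_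
      have := ((tendsto_pow_atTop_nhds_zero_of_lt_one hBq0 hBq1).const_mul
        (A * (1 + 2 * A))).mul_const ‖f‖
      simpa using this
    simpa using (tendsto_const_nhds (x := T f)).sub h2

/-- An operator that is exponentially small on the common kernels of finite families of functionals
of moderate exponential growth is nuclear. -/
theorem isNuclear_of_finset {T : X →L[ℝ] Y} (F : ℕ → Finset (X →L[ℝ] ℝ)) {A B q : ℝ} (hA : 0 ≤ A)
    (hB : 2 ≤ B) (hq : 0 < q) (hBq : B ^ 2 * q < 1)
    (hcard : ∀ n, ((F n).card : ℝ) ≤ A * B ^ n)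
    (hTF : ∀ n f, (∀ φ ∈ F n, φ f = 0) → ‖T f‖ ≤ A * q ^ n * ‖f‖) : IsNuclear T := by
  classical
  have hq1 : q ≤ 1 := by nlinarith
  -- Unions over indices below n make the family monotone and empty at n = 0. The shift by one costs
  -- the factor 1 / q, and ‖T‖ covers n = 0.
  refine isNuclear_of_monotone (A := ‖T‖ + A / q) (fun n => (Finset.range n).biUnion F)
    (fun a b hab => Finset.biUnion_subset_biUnion_of_subset_left _ (Finset.range_mono hab))
    (by simp) (by positivity) (by linarith) hq hBq (fun n => ?_) fun n f hf => ?_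
  · have h1 : (((Finset.range n).biUnion F).card : ℝ) ≤ ∑ k ∈ Finset.range n, A * B ^ k := by
      refine (Nat.cast_le.2 Finset.card_biUnion_le).trans ?_
      push_cast
      exact Finset.sum_le_sum fun k _ => hcard k
    have h2 : ∀ n, ∑ k ∈ Finset.range n, A * B ^ k ≤ A * B ^ n := by
      intro n
      induction n with
      | zero => simpa using hA
      | succ n ih =>
        rw [Finset.sum_range_succ, pow_succ]
        have : 0 ≤ A * B ^ n := by positivity
        nlinarith
    refine (h1.trans (h2 n)).trans (mul_le_mul_of_nonneg_right ?_ (by positivity))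
    have : A ≤ A / q := by rw [le_div_iff₀ hq]; exact mul_le_of_le_one_right hA hq1
    linarith [norm_nonneg T]
  · cases n with
    | zero =>
      refine (T.le_opNorm f).trans (mul_le_mul_of_nonneg_right ?_ (norm_nonneg _))
      rw [pow_zero, mul_one]
      linarith [div_nonneg hA hq.le]
    | succ n =>
      refine (hTF n f fun φ hφ => hf φ (Finset.mem_biUnion.2 ⟨n, by simp, hφ⟩)).trans
        (mul_le_mul_of_nonneg_right ?_ (norm_nonneg _))
      have : (‖T‖ + A / q) * q ^ (n + 1) = ‖T‖ * q ^ (n + 1) + A * q ^ n := by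
        rw [add_mul, pow_succ q n]
        field_simp
      rw [this]
      linarith [mul_nonneg (norm_nonneg T) (pow_nonneg hq.le (n + 1))]

end Nuclear

/-! ### Nets and quasiconvexity of smooth compact sets -/

/-- Bounded subsets of `ℝ^r` have nets of scale `ε / 2 ^ n` with at most `A * (2 ^ r) ^ n` points. -/
theorem exists_dyadic_nets {r : ℕ} {S : Set (EuclideanSpace ℝ (Fin r))} (hS : Bornology.IsBounded S)
    {ε : ℝ} (hε : 0 < ε) :
    ∃ A : ℝ, 0 ≤ A ∧ ∀ n : ℕ, ∃ t : Finset (EuclideanSpace ℝ (Fin r)), ↑t ⊆ S ∧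
      (t.card : ℝ) ≤ A * (2 ^ r) ^ n ∧ ∀ x ∈ S, ∃ y ∈ t, ‖x - y‖ ≤ ε / 2 ^ n := by
  classical
  obtain ⟨R, hR⟩ := hS.exists_norm_le
  -- Cells of side a / 2 ^ n have diameter at most r a / 2 ^ n ≤ ε / 2 ^ n; the extra 1 keeps the
  -- quotient meaningful for r = 0.
  let a := ε / (r + 1)
  have ha : 0 < a := by positivity
  obtain ⟨N, hN⟩ := exists_nat_ge (R / a + 1)
  refine ⟨(2 * N + 1) ^ r, by positivity, fun n => ?_⟩
  let g : EuclideanSpace ℝ (Fin r) → Fin r → ℤ := fun x i => ⌊x i * 2 ^ n / a⌋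
  let I : Finset (Fin r → ℤ) := Fintype.piFinset fun _ => Finset.Icc (-(N * 2 ^ n : ℤ)) (N * 2 ^ n)
  have hcardI : (I.card : ℝ) ≤ (2 * N + 1) ^ r * (2 ^ r) ^ n := by
    have h1 : (I.card : ℝ) = (2 * N * 2 ^ n + 1) ^ r := by
      simp only [I, Fintype.card_piFinset, Int.card_Icc, Finset.prod_const, Finset.card_univ,
        Fintype.card_fin]
      push_cast
      congr 1
      have : ((N * 2 ^ n + 1 - -(N * 2 ^ n) : ℤ).toNat : ℤ) = N * 2 ^ n + 1 - -(N * 2 ^ n) :=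
        Int.toNat_of_nonneg (by linarith [show (0 : ℤ) ≤ N * 2 ^ n by positivity])
      have h := congrArg (Int.cast : ℤ → ℝ) this
      push_cast at h
      rw [h]
      ring
    rw [h1, ← pow_mul, mul_comm r n, pow_mul, ← mul_pow]
    refine pow_le_pow_left₀ (by positivity) ?_ _
    have : (1 : ℝ) ≤ 2 ^ n := one_le_pow₀ (by norm_num)
    nlinarith
  have hgI : ∀ x ∈ S, g x ∈ I := by
    intro x hx
    rw [Fintype.mem_piFinset]
    intro i
    have hxi : |x i| ≤ R := (PiLp.norm_apply_le x i).trans (hR x hx)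
    have h2 : (1 : ℝ) ≤ 2 ^ n := one_le_pow₀ (by norm_num)
    have h3 : |x i * 2 ^ n / a| ≤ (N - 1) * 2 ^ n := by
      rw [mul_div_right_comm, abs_mul, abs_div, abs_of_pos ha, abs_of_pos (by positivity : (0 : ℝ) < 2 ^ n)]
      refine mul_le_mul_of_nonneg_right ?_ (by positivity)
      have := div_le_div_of_nonneg_right hxi ha.le
      linarith
    rw [abs_le] at h3
    rw [Finset.mem_Icc]
    constructor
    · rw [Int.le_floor]
      push_cast
      nlinarith [h3.1]
    · rw [← Int.cast_le (R := ℝ)]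
      push_cast
      refine (Int.floor_le _).trans ?_
      nlinarith [h3.2]
  have hclose : ∀ x y, g x = g y → ‖x - y‖ ≤ ε / 2 ^ n := by
    intro x y hxy
    have hi : ∀ i, |x i - y i| ≤ a / 2 ^ n := by
      intro i
      have h1 := Int.abs_sub_lt_one_of_floor_eq_floor (congrFun hxy i)
      rw [← sub_div, ← sub_mul, mul_div_right_comm, abs_mul, abs_div, abs_of_pos ha,
        abs_of_pos (by positivity : (0 : ℝ) < 2 ^ n)] at h1
      rw [le_div_iff₀ (by positivity)]
      rw [div_mul_eq_mul_div, div_lt_one ha] at h1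
      exact h1.le
    calc ‖x - y‖ ≤ ∑ i, ‖(x - y) i‖ := by
          conv_lhs => rw [← (EuclideanSpace.basisFun (Fin r) ℝ).sum_repr (x - y)]
          refine norm_sum_le_of_le _ fun i _ => ?_
          rw [norm_smul]
          simp
      _ ≤ ∑ _i : Fin r, a / 2 ^ n := Finset.sum_le_sum fun i _ => hi i
      _ = r * (a / 2 ^ n) := by simp
      _ ≤ (r + 1) * (a / 2 ^ n) := by gcongr; linarith
      _ = ε / 2 ^ n := by simp only [a]; field_simp
  -- One point of S is chosen in each cell that meets S, so the net lies in S itself.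
  let J := I.filter fun z => ∃ x ∈ S, g x = z
  choose! c hcS hc using fun z (hz : z ∈ J) => (Finset.mem_filter.1 hz).2
  refine ⟨J.image c, ?_, ?_, fun x hx => ?_⟩
  · intro y hy
    obtain ⟨z, hz, rfl⟩ := Finset.mem_image.1 hy
    exact hcS z hz
  · refine le_trans ?_ hcardI
    exact_mod_cast Finset.card_image_le.trans (Finset.card_filter_le _ _)
  · have hJ : g x ∈ J := Finset.mem_filter.2 ⟨hgI x hx, x, hx, rfl⟩
    exact ⟨c (g x), Finset.mem_image_of_mem _ hJ, hclose _ _ (hc _ hJ).symm⟩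

/-- The interior of a compact set with smooth boundary is uniformly locally quasiconvex: nearby
points are joined by three consecutive segments of comparable total length. -/
theorem SmoothCompact.exists_three_segments {r : ℕ} (K : SmoothCompact r) :
    ∃ C δ : ℝ, 0 < C ∧ 0 < δ ∧ ∀ x ∈ interior K.carrier, ∀ y ∈ interior K.carrier, ‖x - y‖ < δ →
      ∃ z w, segment ℝ x z ⊆ interior K.carrier ∧ segment ℝ z w ⊆ interior K.carrier ∧
        segment ℝ w y ⊆ interior K.carrier ∧ ‖x - z‖ + ‖z - w‖ + ‖w - y‖ ≤ C * ‖x - y‖ := by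
  -- Only x is confined to s, while y is free: this is what makes the property stable under unions.
  let p : Set (EuclideanSpace ℝ (Fin r)) → Prop := fun s => ∃ C δ : ℝ, 0 < C ∧ 0 < δ ∧
    ∀ x ∈ s ∩ interior K.carrier, ∀ y ∈ interior K.carrier, ‖x - y‖ < δ →
      ∃ z w, segment ℝ x z ⊆ interior K.carrier ∧ segment ℝ z w ⊆ interior K.carrier ∧
        segment ℝ w y ⊆ interior K.carrier ∧ ‖x - z‖ + ‖z - w‖ + ‖w - y‖ ≤ C * ‖x - y‖
  suffices h : p K.carrier by
    obtain ⟨C, δ, hC, hδ, h⟩ := h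
    exact ⟨C, δ, hC, hδ, fun x hx => h x ⟨interior_subset hx, hx⟩⟩
  refine K.isCompact.induction_on (p := p) ⟨1, 1, one_pos, one_pos, fun x hx => absurd hx.1 id⟩ ?_ ?_ ?_
  · rintro s t hst ⟨C, δ, hC, hδ, h⟩
    exact ⟨C, δ, hC, hδ, fun x hx => h x ⟨hst hx.1, hx.2⟩⟩
  · rintro s t ⟨C, δ, hC, hδ, h⟩ ⟨C', δ', hC', hδ', h'⟩
    refine ⟨max C C', min δ δ', lt_max_of_lt_left hC, lt_min hδ hδ', fun x hx y hy hxy => ?_⟩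
    rcases hx.1 with hxs | hxt
    · obtain ⟨z, w, h1, h2, h3, h4⟩ := h x ⟨hxs, hx.2⟩ y hy (hxy.trans_le (min_le_left _ _))
      exact ⟨z, w, h1, h2, h3, h4.trans (by gcongr; exact le_max_left _ _)⟩
    · obtain ⟨z, w, h1, h2, h3, h4⟩ := h' x ⟨hxt, hx.2⟩ y hy (hxy.trans_le (min_le_right _ _))
      exact ⟨z, w, h1, h2, h3, h4.trans (by gcongr; exact le_max_right _ _)⟩
  intro q hq
  by_cases hqi : q ∈ interior K.carrier
  · obtain ⟨δ, hδ, hball⟩ := Metric.isOpen_iff.1 isOpen_interior q hqi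
    refine ⟨Metric.ball q (δ / 2), mem_nhdsWithin_of_mem_nhds (Metric.ball_mem_nhds _ (by positivity)),
      1, δ / 2, one_pos, by positivity, fun x hx y hy hxy => ?_⟩
    have hx' : x ∈ Metric.ball q δ := Metric.ball_subset_ball (by linarith) hx.1
    have hy' : y ∈ Metric.ball q δ := by
      have h1 := Metric.mem_ball.1 hx.1
      have h2 := dist_triangle y x q
      rw [dist_comm y x, dist_eq_norm x y] at h2
      exact Metric.mem_ball.2 (by linarith)
    refine ⟨x, y, ?_, ((convex_ball q δ).segment_subset hx' hy').trans hball, ?_, by simp⟩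
    · simpa [segment_same] using hx.2
    · simpa [segment_same] using hy
  obtain ⟨U, hU, hqU, ρ, hρ, hd, hEq⟩ := K.smooth_boundary q ⟨subset_closure hq, hqi⟩
  have hρat : ∀ x ∈ U, ContDiffAt ℝ ∞ ρ x := fun x hx => hρ.contDiffAt (hU.mem_nhds hx)
  have hdiff : ∀ x ∈ U, DifferentiableAt ℝ ρ x := fun x hx => (hρat x hx).differentiableAt (by simp)
  have hfc : ContinuousAt (fderiv ℝ ρ) q :=
    ((hρat q hqU).fderiv_right (m := 0) (by simp)).continuousAt
  -- The vector v points into K: near q, moving along v lowers ρ at rate at least c, while ρ is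
  -- L-Lipschitz.
  obtain ⟨v, hv⟩ : ∃ v, fderiv ℝ ρ q v < 0 := by
    obtain ⟨v, hv⟩ := DFunLike.ne_iff.1 (hd q hqU)
    rcases lt_or_gt_of_ne hv with hv | hv
    · exact ⟨v, hv⟩
    · exact ⟨-v, by simpa using hv⟩
  set c := -(fderiv ℝ ρ q v) / 2 with hcdef
  have hc : 0 < c := by linarith
  set L := ‖fderiv ℝ ρ q‖ + 1 with hLdef
  have hL : 0 < L := by positivity
  have hev : ∀ᶠ x in 𝓝 q, x ∈ U ∧ fderiv ℝ ρ x v < -c ∧ ‖fderiv ℝ ρ x‖ < L := by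
    refine Eventually.and (hU.mem_nhds hqU) (Eventually.and ?_ ?_)
    · have : ContinuousAt (fun x => fderiv ℝ ρ x v) q := hfc.clm_apply continuousAt_const
      exact this.eventually_lt continuousAt_const (by linarith)
    · exact hfc.norm.eventually_lt continuousAt_const (by linarith)
  obtain ⟨δ, hδ, hball⟩ := Metric.eventually_nhds_iff_ball.1 hev
  have hneg : ∀ x ∈ Metric.ball q δ, ρ x < 0 → x ∈ interior K.carrier := by
    intro x hx hx0
    rw [mem_interior_iff_mem_nhds]
    have hxU := (hball x hx).1
    filter_upwards [(hdiff x hxU).continuousAt.eventually_lt continuousAt_const hx0,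
      hU.mem_nhds hxU] with z hz hzU
    have : z ∈ K.carrier ∩ U := by
      rw [hEq]
      exact ⟨hzU, le_of_lt hz⟩
    exact this.1
  have hnonpos : ∀ x ∈ Metric.ball q δ, x ∈ interior K.carrier → ρ x ≤ 0 := by
    intro x hx hxK
    have : x ∈ K.carrier ∩ U := ⟨interior_subset hxK, (hball x hx).1⟩
    rw [hEq] at this
    exact this.2
  have hdesc : ∀ x ∈ Metric.ball q δ, ∀ s : ℝ, 0 ≤ s → x + s • v ∈ Metric.ball q δ →
      ρ (x + s • v) ≤ ρ x - c * s := by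
    intro x hx s hs hxs
    obtain ⟨ξ, hξ, hξeq⟩ := domain_mvt (f := ρ) (f' := fderiv ℝ ρ) (s := Metric.ball q δ)
      (fun z hz => (hdiff z (hball z hz).1).hasFDerivAt.hasFDerivWithinAt) (convex_ball q δ) hx hxs
    have hξb := (hball ξ ((convex_ball q δ).segment_subset hx hxs hξ)).2.1
    rw [add_sub_cancel_left, map_smul, smul_eq_mul] at hξeq
    nlinarith
  have hlip : ∀ x ∈ Metric.ball q δ, ∀ y ∈ Metric.ball q δ, ρ y ≤ ρ x + L * ‖y - x‖ := by
    intro x hx y hy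
    have := (convex_ball q δ).norm_image_sub_le_of_norm_fderiv_le (𝕜 := ℝ)
      (fun z hz => hdiff z (hball z hz).1) (fun z hz => (hball z hz).2.2.le) hx hy
    have := (le_abs_self _).trans this
    linarith
  have hup : ∀ x ∈ Metric.ball q δ, x ∈ interior K.carrier → ∀ s : ℝ, 0 ≤ s →
      x + s • v ∈ Metric.ball q δ → segment ℝ x (x + s • v) ⊆ interior K.carrier := by
    intro x hx hxK s hs hxs z hz
    have hzb := (convex_ball q δ).segment_subset hx hxs hz
    rw [segment_eq_image'] at hz
    obtain ⟨θ, hθ, rfl⟩ := hz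
    simp only [add_sub_cancel_left, smul_smul] at hzb ⊢
    rcases (mul_nonneg hθ.1 hs).eq_or_lt with h0 | h0
    · rw [← h0]; simpa using hxK
    · refine hneg _ hzb ?_
      have := hdesc x hx _ h0.le hzb
      have := hnonpos x hx hxK
      nlinarith
  -- This η keeps the displacement s v below δ / 4 when ‖x - y‖ < η, so both shifted points stay in
  -- the ball of radius δ.
  have hη : 0 < δ / (4 * (1 + 2 * L / c * ‖v‖)) := by positivity
  set η := δ / (4 * (1 + 2 * L / c * ‖v‖)) with hηdef
  have hηδ : η * (1 + 2 * L / c * ‖v‖) = δ / 4 := by rw [hηdef]; field_simp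
  have hη1 : η ≤ δ / 4 := by
    rw [← hηδ]
    exact le_mul_of_one_le_right hη.le (by linarith [show 0 ≤ 2 * L / c * ‖v‖ by positivity])
  refine ⟨Metric.ball q (δ / 2), mem_nhdsWithin_of_mem_nhds (Metric.ball_mem_nhds _ (by positivity)),
    1 + 2 * (2 * L / c * ‖v‖), η, by positivity, hη, fun x hx y hy hxy => ?_⟩
  have hxb : ‖x - q‖ < δ / 2 := by simpa [dist_eq_norm] using hx.1
  have hyb : ‖y - q‖ < 3 * δ / 4 := by
    have := norm_add_le (x - q) (y - x)
    rw [norm_sub_rev y x, show x - q + (y - x) = y - q by abel] at this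
    linarith
  rcases eq_or_ne x y with rfl | hne
  · refine ⟨x, x, ?_, ?_, ?_, by simp⟩ <;> simpa [segment_same] using hy
  have hpos : 0 < ‖x - y‖ := norm_pos_iff.2 (sub_ne_zero.2 hne)
  -- With c s = 2 L ‖x - y‖, the descent at x exceeds the oscillation of ρ, at most L ‖x - y‖, along
  -- the shifted segment, where therefore ρ < 0.
  set s := 2 * L / c * ‖x - y‖ with hsdef
  have hs : 0 < s := by positivity
  have hsv : ‖s • v‖ = 2 * L / c * ‖v‖ * ‖x - y‖ := by
    rw [norm_smul, Real.norm_of_nonneg hs.le, hsdef]; ring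
  have hsvlt : ‖s • v‖ < δ / 4 := by
    rw [hsv]
    have h0 : 0 ≤ 2 * L / c * ‖v‖ := by positivity
    nlinarith
  have hshift : ∀ z, ‖z - q‖ < 3 * δ / 4 → z + s • v ∈ Metric.ball q δ := by
    intro z hz
    rw [Metric.mem_ball, dist_eq_norm, add_sub_right_comm]
    exact (norm_add_le _ _).trans_lt (by linarith)
  have hxB : x ∈ Metric.ball q δ := by rw [Metric.mem_ball, dist_eq_norm]; linarith
  have hyB : y ∈ Metric.ball q δ := by rw [Metric.mem_ball, dist_eq_norm]; linarith
  have hxs := hshift x (by linarith)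
  have hys := hshift y hyb
  refine ⟨x + s • v, y + s • v, hup x hxB hx.2 s hs.le hxs, fun z hz => ?_, ?_, ?_⟩
  · have hzb := (convex_ball q δ).segment_subset hxs hys hz
    refine hneg z hzb ?_
    have h1 := hlip _ hxs z hzb
    have h2 := hdesc x hxB s hs.le hxs
    have h3 := hnonpos x hxB hx.2
    have h4 : ‖z - (x + s • v)‖ ≤ ‖x - y‖ := by
      rw [segment_eq_image'] at hz
      obtain ⟨θ, hθ, rfl⟩ := hz
      rw [add_sub_cancel_left, add_sub_add_right_eq_sub, norm_smul, Real.norm_of_nonneg hθ.1,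
        norm_sub_rev]
      exact mul_le_of_le_one_left (norm_nonneg _) hθ.2
    have h5 : c * s = 2 * L * ‖x - y‖ := by rw [hsdef]; field_simp
    have h6 := mul_le_mul_of_nonneg_left h4 hL.le
    nlinarith [mul_pos hL hpos]
  · rw [segment_symm]
    exact hup y hyB hy s hs.le hys
  · have h1 : ‖x - (x + s • v)‖ = ‖s • v‖ := by rw [sub_add_cancel_left, norm_neg]
    rw [h1, add_sub_add_right_eq_sub, add_sub_cancel_left, hsv]
    linarith

/-! ### Derivative estimates and nuclearity of a single inclusion -/

/-- The left side counts the tuples of coordinate directions of length less than n, that is, the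
functionals used at each net point. -/
theorem sum_pow_le_succ_pow {r : ℕ} (hr : 0 < r) (n : ℕ) :
    ∑ j : Fin n, r ^ (j : ℕ) ≤ (r + 1) ^ n := by
  rw [Fin.sum_univ_eq_sum_range (fun j => r ^ j)]
  induction n with
  | zero => simp
  | succ n ih =>
    rw [Finset.sum_range_succ, pow_succ, mul_add, mul_one, add_comm]
    exact add_le_add ((Nat.pow_le_pow_left r.le_succ n).trans (Nat.le_mul_of_pos_right _ hr)) ih

section Inclusion

variable {r : ℕ} {K : SmoothCompact r} {M N : WeightSequence} {h k : Ioi (0 : ℝ)}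

theorem IsSmoothOn.norm_derivOn_le {f : EuclideanSpace ℝ (Fin r) → ℝ} (hf : IsSmoothOn K f) {j : ℕ}
    {b : ℝ} (hb : ∀ x ∈ interior K.carrier, ‖iteratedFDeriv ℝ j f x‖ ≤ b)
    {x : EuclideanSpace ℝ (Fin r)} (hx : x ∈ K.carrier) : ‖derivOn K f j x‖ ≤ b := by
  have : (𝓝[interior K.carrier] x).NeBot :=
    mem_closure_iff_nhdsWithin_neBot.1 (K.subset_closure_interior hx)
  exact le_of_tendsto (hf.tendsto j hx).norm (eventually_nhdsWithin_of_forall hb)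

theorem IsSmoothOn.norm_iteratedFDeriv_sub_le {f : EuclideanSpace ℝ (Fin r) → ℝ}
    (hf : IsSmoothOn K f) {j : ℕ} {b : ℝ}
    (hb : ∀ x ∈ interior K.carrier, ‖iteratedFDeriv ℝ (j + 1) f x‖ ≤ b)
    {x y : EuclideanSpace ℝ (Fin r)} (hxy : segment ℝ x y ⊆ interior K.carrier) :
    ‖iteratedFDeriv ℝ j f x - iteratedFDeriv ℝ j f y‖ ≤ b * ‖x - y‖ := by
  refine (convex_segment x y).norm_image_sub_le_of_norm_fderiv_le (𝕜 := ℝ) (fun z hz => ?_)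
    (fun z hz => ?_) (right_mem_segment ℝ x y) (left_mem_segment ℝ x y)
  · exact ((hf.contDiffAt (j + 1) (hxy hz)).iteratedFDeriv_right (m := 1) (i := j)
      (by push_cast; rw [add_comm])).differentiableAt (by simp)
  · rw [norm_fderiv_iteratedFDeriv]
    exact hb z (hxy hz)

namespace UltraSpace

theorem norm_derivOn_le (f : UltraSpace K M h) (j : ℕ) {x : EuclideanSpace ℝ (Fin r)}
    (hx : x ∈ K.carrier) : ‖derivOn K f.1 j x‖ ≤ (h : ℝ) ^ j * M j * ‖f‖ := by
  have := weightedQuot_le_norm f (j, ⟨x, hx⟩)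
  rw [weightedQuot, div_le_iff₀ (weight_pos M h j)] at this
  linarith

theorem norm_iteratedFDeriv_le (f : UltraSpace K M h) (j : ℕ) {x : EuclideanSpace ℝ (Fin r)}
    (hx : x ∈ interior K.carrier) : ‖iteratedFDeriv ℝ j f.1 x‖ ≤ (h : ℝ) ^ j * M j * ‖f‖ := by
  rw [← f.2.1.derivOn_of_mem_interior j hx]
  exact f.norm_derivOn_le j (interior_subset hx)

/-- The functional `f ↦ f⁽ʲ⁾(x)(e_{s 0}, …, e_{s (j - 1)})`. -/
noncomputable def partialDeriv (K : SmoothCompact r) (M : WeightSequence) (h : Ioi (0 : ℝ)) (x : K.carrier)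
    (j : ℕ) (s : Fin j → Fin r) : UltraSpace K M h →L[ℝ] ℝ :=
  LinearMap.mkContinuous
    { toFun := fun f => derivOn K f.1 j x fun i => EuclideanSpace.basisFun (Fin r) ℝ (s i)
      map_add' := fun f g => by
        change derivOn K (f.1 + g.1) j x _ = _
        rw [derivOn_add f.2.1 g.2.1 j x.2, add_apply]
      map_smul' := fun c f => by
        change derivOn K (c • f.1) j x _ = _
        rw [derivOn_smul c f.2.1 j x.2, smul_apply]
        rfl }
    ((h : ℝ) ^ j * M j) fun f => by
      refine (ContinuousMultilinearMap.le_opNorm _ _).trans ?_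
      simpa using f.norm_derivOn_le j x.2

theorem partialDeriv_apply (x : K.carrier) (j : ℕ) (s : Fin j → Fin r) (f : UltraSpace K M h) :
    partialDeriv K M h x j s f =
      derivOn K f.1 j x fun i => EuclideanSpace.basisFun (Fin r) ℝ (s i) := rfl

theorem derivOn_eq_zero {f : UltraSpace K M h} {x : K.carrier} {j : ℕ}
    (hf : ∀ s, partialDeriv K M h x j s f = 0) : derivOn K f.1 j x = 0 := by
  apply ContinuousMultilinearMap.toMultilinearMap_injective
  refine Module.Basis.ext_multilinear
    (fun _ => (EuclideanSpace.basisFun (Fin r) ℝ).toBasis) fun s => ?_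
  simpa [partialDeriv_apply] using hf s

/-- Poincaré-type estimate: if the derivatives of order less than `n` vanish on a fine net, then
the derivatives gain a power of the scale of the net. -/
theorem norm_iteratedFDeriv_le_of_net {C δ ε : ℝ} (hC : 0 < C) (hε : ε < δ)
    (hseg : ∀ x ∈ interior K.carrier, ∀ y ∈ interior K.carrier, ‖x - y‖ < δ →
      ∃ z w, segment ℝ x z ⊆ interior K.carrier ∧ segment ℝ z w ⊆ interior K.carrier ∧
        segment ℝ w y ⊆ interior K.carrier ∧ ‖x - z‖ + ‖z - w‖ + ‖w - y‖ ≤ C * ‖x - y‖)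
    {t : Set (EuclideanSpace ℝ (Fin r))} (htK : t ⊆ interior K.carrier)
    (ht : ∀ x ∈ interior K.carrier, ∃ y ∈ t, ‖x - y‖ ≤ ε) {f : UltraSpace K M h} {n : ℕ}
    (hf : ∀ y ∈ t, ∀ j < n, iteratedFDeriv ℝ j f.1 y = 0) (l j : ℕ) (hjl : j + l ≤ n)
    {x : EuclideanSpace ℝ (Fin r)} (hx : x ∈ interior K.carrier) :
    ‖iteratedFDeriv ℝ j f.1 x‖ ≤ (C * ε) ^ l * ((h : ℝ) ^ (j + l) * M (j + l) * ‖f‖) := by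
  induction l generalizing j x with
  | zero => simpa using f.norm_iteratedFDeriv_le j hx
  | succ l ih =>
    obtain ⟨y, hy, hxy⟩ := ht x hx
    have hε0 : 0 ≤ ε := (norm_nonneg _).trans hxy
    obtain ⟨z, w, h1, h2, h3, h4⟩ := hseg x hx y (htK hy) (hxy.trans_lt hε)
    -- One integration along the three segments from y, where the derivative of order j vanishes,
    -- trades one order for a factor C ε.
    set b := (C * ε) ^ l * ((h : ℝ) ^ (j + 1 + l) * M (j + 1 + l) * ‖f‖) with hbdef
    have hb : ∀ x ∈ interior K.carrier, ‖iteratedFDeriv ℝ (j + 1) f.1 x‖ ≤ b :=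
      fun x hx => ih (j + 1) (by omega) hx
    have hb0 : 0 ≤ b := (norm_nonneg _).trans (hb x hx)
    have g1 := f.2.1.norm_iteratedFDeriv_sub_le hb h1
    have g2 := f.2.1.norm_iteratedFDeriv_sub_le hb h2
    have g3 := f.2.1.norm_iteratedFDeriv_sub_le hb h3
    have g4 := hf y hy j (by omega)
    calc ‖iteratedFDeriv ℝ j f.1 x‖
        = ‖(iteratedFDeriv ℝ j f.1 x - iteratedFDeriv ℝ j f.1 z)
          + (iteratedFDeriv ℝ j f.1 z - iteratedFDeriv ℝ j f.1 w)
          + (iteratedFDeriv ℝ j f.1 w - iteratedFDeriv ℝ j f.1 y)‖ := by rw [g4]; congr 1; abel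
      _ ≤ b * ‖x - z‖ + b * ‖z - w‖ + b * ‖w - y‖ :=
          norm_add₃_le.trans (add_le_add (add_le_add g1 g2) g3)
      _ = b * (‖x - z‖ + ‖z - w‖ + ‖w - y‖) := by ring
      _ ≤ b * (C * ε) :=
          mul_le_mul_of_nonneg_left (h4.trans (mul_le_mul_of_nonneg_left hxy hC.le)) hb0
      _ = (C * ε) ^ (l + 1) * ((h : ℝ) ^ (j + (l + 1)) * M (j + (l + 1)) * ‖f‖) := by
          rw [hbdef, show j + 1 + l = j + (l + 1) by omega]; ring

/-- The hypotheses on q, c, D and m do not involve K; its geometric constants C, δ and A₀ enter only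
the prefactor. -/
theorem isNuclear_inclusion (K : SmoothCompact r) (hr : 0 < r) (hMN : ∀ j, M j ≤ N j) (hhk : h ≤ k)
    {q c D : ℝ} {m : ℕ} (hq : 0 < q) (hBq : ((2 : ℝ) ^ r * (r + 1)) ^ 2 * q < 1)
    (hmq : (1 / 2 : ℝ) ^ m ≤ q) (hhq : (h : ℝ) ≤ q * k) (hD : 0 < D) (hhD : D * h ≤ k)
    (hM : ∀ j, M (j + m) ≤ c * D ^ j * N j) : IsNuclear (inclusion K hMN hhk) := by
  classical
  have hh : (0 : ℝ) < h := h.2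
  have hk : (0 : ℝ) < k := k.2
  have hc : 0 < c := by
    have h1 := (M.pos _).trans_le (hM 0)
    rw [pow_zero, mul_one] at h1
    exact pos_of_mul_pos_left h1 (N.pos 0).le
  obtain ⟨C, δ, hC, hδ, hseg⟩ := K.exists_three_segments
  obtain ⟨A₀, hA₀, hnet⟩ := exists_dyadic_nets
    (K.isCompact.isBounded.subset interior_subset) (half_pos hδ)
  choose t htK htcard ht using hnet
  -- Orders up to n + m - 1 are included so that every order j ≤ n admits m integrations.
  let F : ℕ → Finset (UltraSpace K M h →L[ℝ] ℝ) := fun n =>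
    (Finset.univ : Finset (t n × Σ j : Fin (n + m), Fin (j : ℕ) → Fin r)).image fun p =>
      partialDeriv K M h ⟨p.1, interior_subset (htK n p.1.2)⟩ p.2.1 p.2.2
  refine isNuclear_of_finset (A := A₀ * (r + 1) ^ m + (C * (δ / 2) * h) ^ m * c + 1)
    (B := 2 ^ r * (r + 1)) F (by positivity) ?_ hq hBq (fun n => ?_) fun n f hf => ?_
  · have h1 : (2 : ℝ) ^ 1 ≤ 2 ^ r := pow_le_pow_right₀ (by norm_num) hr
    have h2 : (0 : ℝ) ≤ r := r.cast_nonneg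
    nlinarith
  · have h1 : (F n).card ≤ (t n).card * (r + 1) ^ (n + m) := by
      refine Finset.card_image_le.trans ?_
      rw [Finset.card_univ, Fintype.card_prod, Fintype.card_sigma]
      simpa using Nat.mul_le_mul_left _ (sum_pow_le_succ_pow hr (n + m))
    calc ((F n).card : ℝ) ≤ (t n).card * (r + 1) ^ (n + m) := by exact_mod_cast h1
      _ ≤ (A₀ * (2 ^ r) ^ n) * (r + 1) ^ (n + m) :=
          mul_le_mul_of_nonneg_right (htcard n) (by positivity)
      _ = A₀ * (r + 1) ^ m * (2 ^ r * (r + 1)) ^ n := by rw [mul_pow, pow_add]; ring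
      _ ≤ _ := mul_le_mul_of_nonneg_right (by
          linarith [show 0 ≤ (C * (δ / 2) * h) ^ m * c by positivity]) (by positivity)
  · have hvan : ∀ y ∈ (t n : Set (EuclideanSpace ℝ (Fin r))), ∀ j < n + m,
        iteratedFDeriv ℝ j f.1 y = 0 := by
      intro y hy j hj
      rw [← f.2.1.derivOn_of_mem_interior j (htK n hy)]
      exact derivOn_eq_zero (x := ⟨y, interior_subset (htK n hy)⟩) fun s =>
        hf _ (Finset.mem_image.2 ⟨(⟨y, hy⟩, ⟨⟨j, hj⟩, s⟩), Finset.mem_univ _, rfl⟩)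
    have hε : δ / 2 / 2 ^ n < δ := by
      rw [div_lt_iff₀ (by positivity)]
      have : (1 : ℝ) ≤ 2 ^ n := one_le_pow₀ (by norm_num)
      nlinarith
    have hq1 : q ≤ 1 := by
      by_contra hcon
      have : (1 : ℝ) ≤ 2 ^ r * (r + 1) := by
        have h1 : (1 : ℝ) ≤ 2 ^ r := one_le_pow₀ (by norm_num)
        have h2 : (0 : ℝ) ≤ r := r.cast_nonneg
        nlinarith
      nlinarith
    have hkey : ∀ j, ∀ x ∈ interior K.carrier, ‖iteratedFDeriv ℝ j f.1 x‖ ≤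
        ((C * (δ / 2) * h) ^ m * c + 1) * q ^ n * ‖f‖ * ((k : ℝ) ^ j * N j) := by
      intro j x hx
      have hN := N.pos j
      -- Low orders gain (1/2)^(mn) ≤ q^n from the net, `hM` and D h ≤ k absorbing the shift of the
      -- weight; high orders gain q^j ≤ q^n from h ≤ q k.
      rcases le_or_gt j n with hjn | hjn
      · refine (norm_iteratedFDeriv_le_of_net hC hε hseg (htK n) (ht n) hvan m j (by omega) hx).trans ?_
        have e1 : ((1 / 2 : ℝ) ^ m) ^ n ≤ q ^ n := pow_le_pow_left₀ (by positivity) hmq n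
        have e2 : (D * h) ^ j ≤ (k : ℝ) ^ j := pow_le_pow_left₀ (by positivity) hhD j
        calc (C * (δ / 2 / 2 ^ n)) ^ m * ((h : ℝ) ^ (j + m) * M (j + m) * ‖f‖)
            ≤ (C * (δ / 2 / 2 ^ n)) ^ m * ((h : ℝ) ^ (j + m) * (c * D ^ j * N j) * ‖f‖) := by
              gcongr
              exact hM j
          _ = (C * (δ / 2) * h) ^ m * c * ((1 / 2 : ℝ) ^ m) ^ n * ‖f‖ * ((D * h) ^ j * N j) := by
              rw [← pow_mul, mul_comm m n, pow_mul, one_div, inv_pow]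
              simp only [div_eq_mul_inv, mul_pow, pow_add]
              ring
          _ ≤ (C * (δ / 2) * h) ^ m * c * q ^ n * ‖f‖ * ((k : ℝ) ^ j * N j) := by gcongr
          _ ≤ _ := by gcongr; linarith
      · refine (f.norm_iteratedFDeriv_le j hx).trans ?_
        have e1 : (h : ℝ) ^ j ≤ q ^ n * k ^ j := by
          calc (h : ℝ) ^ j ≤ (q * k) ^ j := pow_le_pow_left₀ hh.le hhq j
            _ = q ^ j * k ^ j := mul_pow _ _ _
            _ ≤ q ^ n * k ^ j := mul_le_mul_of_nonneg_right
                (pow_le_pow_of_le_one hq.le hq1 hjn.le) (by positivity)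
        calc (h : ℝ) ^ j * M j * ‖f‖ ≤ q ^ n * k ^ j * N j * ‖f‖ := by
              gcongr
              · exact (M.pos j).le
              · exact hMN j
          _ = 1 * q ^ n * ‖f‖ * ((k : ℝ) ^ j * N j) := by ring
          _ ≤ _ := by
              gcongr
              linarith [show 0 ≤ (C * (δ / 2) * h) ^ m * c by positivity]
    refine norm_le' (by positivity) fun p => ?_
    have h1 : weightedQuot K N k f.1 p ≤ ((C * (δ / 2) * h) ^ m * c + 1) * q ^ n * ‖f‖ := by
      rw [weightedQuot, div_le_iff₀ (weight_pos N k p.1)]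
      exact f.2.1.norm_derivOn_le (hkey p.1) p.2.2
    refine h1.trans ?_
    gcongr
    linarith [show 0 ≤ A₀ * (r + 1 : ℝ) ^ m by positivity]

end UltraSpace

end Inclusion

/-! ### Iterated derivation closedness and conclusion -/

theorem RoumieuDC.iterate {Λ : Type*} [PartialOrder Λ] [IsDirected Λ (· ≤ ·)]
    {M : Λ → WeightSequence} (hM : IsWeightMatrix M) (h : RoumieuDC M) (m : ℕ) (x : Λ) :
    ∃ y, x ≤ y ∧ ∃ c D : ℝ, 0 < c ∧ 0 < D ∧ ∀ j, M x (j + m) ≤ c * D ^ j * M y j := by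
  induction m with
  | zero => exact ⟨x, le_rfl, 1, 1, one_pos, one_pos, fun j => by simp⟩
  | succ m ih =>
    obtain ⟨y, -, c, D, hc, hD, hy⟩ := ih
    obtain ⟨C, hC, z, hz⟩ := h y
    -- Derivation closedness does not relate z to x in the order, so directedness supplies an index
    -- above both.
    obtain ⟨w, hxw, hzw⟩ := exists_ge_ge x z
    refine ⟨w, hxw, c * D * C, D * C, by positivity, by positivity, fun j => ?_⟩
    calc M x (j + (m + 1)) = M x (j + 1 + m) := by rw [add_assoc, add_comm 1 m]
      _ ≤ c * D ^ (j + 1) * M y (j + 1) := hy _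
      _ ≤ c * D ^ (j + 1) * (C ^ (j + 1) * M w j) := by
          gcongr
          exact (hz j).trans (by gcongr; exact hM.le_of_le hzw j)
      _ = _ := by rw [mul_pow]; ring

theorem BeurlingDC.iterate {Λ : Type*} [PartialOrder Λ] [IsDirected Λ (· ≥ ·)]
    {M : Λ → WeightSequence} (hM : IsWeightMatrix M) (h : BeurlingDC M) (m : ℕ) (y : Λ) :
    ∃ x, x ≤ y ∧ ∃ c D : ℝ, 0 < c ∧ 0 < D ∧ ∀ j, M x (j + m) ≤ c * D ^ j * M y j := by
  induction m with
  | zero => exact ⟨y, le_rfl, 1, 1, one_pos, one_pos, fun j => by simp⟩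
  | succ m ih =>
    obtain ⟨x, -, c, D, hc, hD, hx⟩ := ih
    obtain ⟨C, hC, z, hz⟩ := h x
    obtain ⟨w, hwy, hwz⟩ := exists_le_le y z
    refine ⟨w, hwy, c * C ^ (m + 1), D * C, by positivity, by positivity, fun j => ?_⟩
    calc M w (j + (m + 1)) ≤ M z (j + m + 1) := hM.le_of_le hwz _
      _ ≤ C ^ (j + m + 1) * M x (j + m) := hz _
      _ ≤ C ^ (j + m + 1) * (c * D ^ j * M y j) := by
          gcongr
          exact hx j
      _ = _ := by rw [mul_pow]; ring

theorem mainTheorem10 {Λ : Type*} [PartialOrder Λ] [IsDirected Λ (· ≤ ·)] [IsDirected Λ (· ≥ ·)]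
    (r : ℕ) (hr : 0 < r) (M : Λ → WeightSequence) (hM : IsWeightMatrix M) :
    (RoumieuDC M → ∀ (x : Λ) (h : Set.Ioi (0 : ℝ)), ∃ (y : Λ) (k : Set.Ioi (0 : ℝ))
      (hxy : x ≤ y) (hhk : h ≤ k), ∀ K : SmoothCompact r,
        IsNuclear (UltraSpace.inclusion K (hM.le_of_le hxy) hhk)) ∧
    (BeurlingDC M → ∀ (y : Λ) (k : Set.Ioi (0 : ℝ)), ∃ (x : Λ) (h : Set.Ioi (0 : ℝ))
      (hxy : x ≤ y) (hhk : h ≤ k), ∀ K : SmoothCompact r,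
        IsNuclear (UltraSpace.inclusion K (hM.le_of_le hxy) hhk)) := by
  -- First q and then m are fixed from r alone, before any compact set appears.
  obtain ⟨q, hq, hBq⟩ : ∃ q : ℝ, 0 < q ∧ ((2 : ℝ) ^ r * (r + 1)) ^ 2 * q < 1 :=
    ⟨(2 * ((2 : ℝ) ^ r * (r + 1)) ^ 2)⁻¹, by positivity, by field_simp; norm_num⟩
  obtain ⟨m, hm⟩ := exists_pow_lt_of_lt_one hq (by norm_num : (1 / 2 : ℝ) < 1)
  refine ⟨fun hR x h => ?_, fun hB y k => ?_⟩
  · have hh : (0 : ℝ) < h := h.2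
    obtain ⟨y, hxy, c, D, -, hD, hy⟩ := hR.iterate hM m x
    refine ⟨y, ⟨max h (max (h / q) (D * h)), mem_Ioi.2 (lt_max_of_lt_left hh)⟩, hxy,
      Subtype.coe_le_coe.1 (le_max_left _ _), fun K => ?_⟩
    refine UltraSpace.isNuclear_inclusion K hr _ _ hq hBq hm.le ?_ hD ?_ hy
    · rw [← div_le_iff₀' hq]
      exact (le_max_left _ _).trans (le_max_right _ _)
    · exact (le_max_right _ _).trans (le_max_right _ _)
  · have hk : (0 : ℝ) < k := k.2
    obtain ⟨x, hxy, c, D, -, hD, hx⟩ := hB.iterate hM m y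
    refine ⟨x, ⟨min k (min (q * k) (k / D)),
      mem_Ioi.2 (lt_min hk (lt_min (by positivity) (by positivity)))⟩, hxy,
      Subtype.coe_le_coe.1 (min_le_left _ _), fun K => ?_⟩
    refine UltraSpace.isNuclear_inclusion K hr _ _ hq hBq hm.le ?_ hD ?_ hx
    · exact (min_le_right _ _).trans (min_le_left _ _)
    · rw [← le_div_iff₀' hD]
      exact (min_le_right _ _).trans (min_le_right _ _)
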